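/- Let $n\ge 2$, let $\mu$ be a probability distribution on $\mathbb R^n$ whose joint distribution function $G(t_1,\dots,t_n)=\mu\{y: y_1\le t_1,\dots,y_n\le t_n\}$ is continuous (the coordinates may be dependent), and let $y_1,\dots,y_N$ be independent random vectors in $\mathbb R^n$ with distribution $\mu$. Let $r_1,\dots,r_n$ and $s_1,\dots,s_n$ be integers with $$0\le r_1\le r_2\le\cdots\le r_n,\qquad r_j<s_j\ (1\le j\le n),\qquad s_1\le N,\qquad s_{j}\le s_{j-1}-r_{j-1}-1\ (2\le j\le n).$$ Construct random limits as follows. Start with the set of all $N$ observations. For $j=1,\dots,n$ in turn, arrange the $j$-th coordinates of the observations still in the set in increasing order, let $L_j$ be the $r_j$-th and $U_j$ the $s_j$-th of these values (the $0$-th value being $-\infty$), and keep in the set only those observations whose $j$-th coordinate lies strictly between $L_j$ and $U_j$. Then all $L_j$ and $U_j$ are random variables with values in the extended reals (functions of the sample only), and for every $0<\gamma<1$ $$\mathcal P\left\{\mu\left([L_1,U_1]\times\cdots\times[L_n,U_n]\right)>\gamma\right\}=1-I(\gamma,\;s_n-r_n,\;N-s_n+r_n+1),$$ where $I(\gamma,a,b)=\frac1{B(a,b)}\int_0^\gamma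 u^{a-1}(1-u)^{b-1}\,du$ is the regularized incomplete beta function, with $B$ the Euler beta function. In particular, if $\mu$ has a joint density $g$, then $$\mathcal P\left\{\int_{L_1}^{U_1}\cdots\int_{L_n}^{U_n} g(y_1,\dots,y_n)\,dy_1\cdots dy_n>\gamma\right\}=1-I(\gamma,\;s_n-r_n,\;N-s_n+r_n+1),$$ so this probability does not depend on $g$. -/

import Mathlib

open MeasureTheory ProbabilityTheory

noncomputable section

/-- The regularized incomplete beta function
`I(x, a, b) = (∫_0^x u^(a-1) (1-u)^(b-1) du) / B(a, b)`, where `B` is the Euler beta function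
(used for `a, b > 0` and `0 ≤ x ≤ 1`). -/
def regIncBeta (x a b : ℝ) : ℝ :=
  (∫ u in (0 : ℝ)..x, u ^ (a - 1) * (1 - u) ^ (b - 1)) / ProbabilityTheory.beta a b

/-- The joint cumulative distribution function `G(t₁, …, tₙ) = μ {y | y₁ ≤ t₁, …, yₙ ≤ tₙ}`. -/
def jointCDF {n : ℕ} (μ : Measure (Fin n → ℝ)) (t : Fin n → ℝ) : ℝ :=
  μ.real {y | ∀ j, y j ≤ t j}

/-- The `k`-th smallest of the values `z i`, `i ∈ A` (counted from `k = 1`, with multiplicity).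
By convention the `0`-th one is `-∞`, and those beyond the number of values are `+∞`. -/
def orderStat {N : ℕ} (A : Finset (Fin N)) (z : Fin N → ℝ) (k : ℕ) : EReal :=
  (⊥ :: ((A.val.map z).sort (· ≤ ·)).map Real.toEReal).getD k ⊤

open Classical in
/-- The observations that are still in play after the first `j` coordinates have been treated.
Initially these are all the observations; coordinate `j` keeps those that lie strictly between the
`r j`-th and the `s j`-th smallest value of this coordinate among the ones still in play.
Here `x i` is the `i`-th observation, a vector with `n` coordinates. -/
def survivors {n N : ℕ} (r s : Fin n → ℕ) (x : Fin N → Fin n → ℝ) : ℕ → Finset (Fin N)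
  | 0 => Finset.univ
  | j + 1 => (survivors r s x j).filter fun i => ∀ h : j < n,
      orderStat (survivors r s x j) (fun l => x l ⟨j, h⟩) (r ⟨j, h⟩) < (x i ⟨j, h⟩ : EReal) ∧
      (x i ⟨j, h⟩ : EReal) < orderStat (survivors r s x j) (fun l => x l ⟨j, h⟩) (s ⟨j, h⟩)

/-- The lower tolerance limit of coordinate `j`. -/
def lowerLimit {n N : ℕ} (r s : Fin n → ℕ) (x : Fin N → Fin n → ℝ) (j : Fin n) : EReal :=
  orderStat (survivors r s x j) (fun l => x l j) (r j)

/-- The upper tolerance limit of coordinate `j`. -/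
def upperLimit {n N : ℕ} (r s : Fin n → ℕ) (x : Fin N → Fin n → ℝ) (j : Fin n) : EReal :=
  orderStat (survivors r s x j) (fun l => x l j) (s j)

/-- The tolerance region `[L₁, U₁] × ⋯ × [Lₙ, Uₙ]`, as a set of points of `ℝⁿ`. -/
def toleranceBox {n N : ℕ} (r s : Fin n → ℕ) (x : Fin N → Fin n → ℝ) : Set (Fin n → ℝ) :=
  {v | ∀ j, lowerLimit r s x j ≤ (v j : EReal) ∧ (v j : EReal) ≤ upperLimit r s x j}

/-- Admissible ranks for a sample of size `N`: `0 ≤ r₁ < s₁ ≤ N`, `r₁ ≤ r₂ ≤ ⋯ ≤ rₙ`, and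
`r_{j+1} < s_{j+1} ≤ s_j - r_j - 1`; the last inequality is written without subtraction. -/
structure AdmissibleRanks {n : ℕ} (N : ℕ) (r s : Fin n → ℕ) : Prop where
  mono : Monotone r
  lt : ∀ j, r j < s j
  first : ∀ h : 0 < n, s ⟨0, h⟩ ≤ N
  step : ∀ (j : ℕ) (h : j + 1 < n),
    s ⟨j + 1, h⟩ + r ⟨j, Nat.lt_of_succ_lt h⟩ + 1 ≤ s ⟨j, Nat.lt_of_succ_lt h⟩

end

/-! The limits are produced by one-sided cuts: a cut by a function `f` deletes the remaining
observation with the largest `f` and keeps the points where `f` is smaller. Coordinate `j` amounts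
to `r j` cuts by `-v j`, then enough cuts by `v j` to delete everything from the `s j`-th value
upward. Without ties, survivor counts do not depend on the sample, so neither does the list of cuts
(`AdmissibleRanks.exists_cuts`).

For an atomless `f` and a finite measure of mass `m`, the mass below a random point's `f`-value is
uniform on `(0, m]`. Given the largest observation, the others follow the measure restricted below
it, so the problem recurs with a smaller mass and one observation fewer. The law of the remaining
mass thus depends only on the numbers of cuts and observations (`pi_lt_measureReal_cutRegion`).
Solving the recursion gives a beta integral (`cutTail_succ`), with parameters the number of final
survivors plus one, `s last - r last`, and the number of cuts. -/

open scoped ENNReal Topology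

/-! ### Order statistics through counting. -/

section OrderStat

theorem List.getElem_le_iff_lt_countP {α : Type*} [LinearOrder α] {l : List α}
    (hl : l.Pairwise (· ≤ ·)) (c : α) {k : ℕ} (hk : k < l.length) :
    l[k] ≤ c ↔ k < l.countP (fun a => decide (a ≤ c)) := by
  induction l generalizing k with
  | nil => simp at hk
  | cons a t ih =>
    rw [List.pairwise_cons] at hl
    by_cases hac : a ≤ c
    · cases k with
      | zero => simp [hac]
      | succ k => simp [hac, ih hl.2 (by simpa using hk)]
    · have h0 : t.countP (fun a => decide (a ≤ c)) = 0 := by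
        rw [List.countP_eq_zero]
        intro b hb
        simpa using (not_le.1 hac).trans_le (hl.1 b hb)
      rw [List.countP_cons, h0]
      have hk' : a ≤ (a :: t)[k] := by
        cases k with
        | zero => simp
        | succ k => exact hl.1 _ (by simp)
      simpa [hac] using (not_le.1 hac).trans_le hk'

variable {N : ℕ} (A : Finset (Fin N)) (z : Fin N → ℝ)

theorem orderStat_zero : orderStat A z 0 = ⊥ := by simp [orderStat]

theorem orderStat_of_card_lt {k : ℕ} (hk : A.card < k) : orderStat A z k = ⊤ := by
  rw [orderStat, List.getD_eq_default]
  simpa using hk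

theorem orderStat_succ {k : ℕ} (hk : k < A.card) :
    orderStat A z (k + 1) =
      (((A.val.map z).sort (· ≤ ·))[k]'(by simpa using hk) : ℝ) := by
  rw [orderStat, List.getD_cons_succ, List.getD_eq_getElem _ _ (by simpa using hk),
    List.getElem_map]

theorem orderStat_le_iff {k : ℕ} (hk : k ≤ A.card) (c : ℝ) :
    orderStat A z k ≤ c ↔ k ≤ (A.filter fun i => z i ≤ c).card := by
  cases k with
  | zero => simp [orderStat_zero]
  | succ k =>
    rw [orderStat_succ A z hk, EReal.coe_le_coe_iff,
      List.getElem_le_iff_lt_countP (Multiset.pairwise_sort _ _), Nat.lt_iff_add_one_le]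
    rw [← Multiset.coe_countP, Multiset.sort_eq, Multiset.countP_map, Finset.card_def,
      Finset.filter_val]

theorem exists_orderStat_eq {k : ℕ} (hk0 : k ≠ 0) (hk : k ≤ A.card) :
    ∃ i ∈ A, orderStat A z k = z i := by
  obtain ⟨k, rfl⟩ := Nat.exists_eq_succ_of_ne_zero hk0
  have hk : k < A.card := hk
  have h : ((A.val.map z).sort (· ≤ ·))[k]'(by simpa using hk) ∈ A.val.map z :=
    (Multiset.mem_sort (r := (· ≤ ·))).1 (List.getElem_mem _)
  obtain ⟨i, hi, hiz⟩ := Multiset.mem_map.1 h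
  exact ⟨i, hi, by rw [orderStat_succ A z hk, hiz]⟩

variable {A z}

/-- Injectivity is essential: a tie at the `k`-th value would make the count exceed `k`. -/
theorem card_filter_le_orderStat (hz : Set.InjOn z A) {k : ℕ} (hk : k ≤ A.card) :
    (A.filter fun i => (z i : EReal) ≤ orderStat A z k).card = k := by
  rcases Nat.eq_zero_or_pos k with rfl | hk0
  · simp [orderStat_zero]
  obtain ⟨a, ha, hw⟩ := exists_orderStat_eq A z hk0.ne' hk
  simp only [hw, EReal.coe_le_coe_iff]
  refine le_antisymm ?_ ((orderStat_le_iff A z hk _).1 hw.le)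
  by_contra! hlt
  have hmem : a ∈ A.filter fun i => z i ≤ z a := by simp [ha]
  have hcard := Finset.card_erase_of_mem hmem
  set S := (A.filter fun i => z i ≤ z a).erase a with hS
  have hSne : S.Nonempty := Finset.card_pos.1 (by omega)
  obtain ⟨b, hb, hmax⟩ := S.exists_max_image z hSne
  simp only [hS, Finset.mem_erase, Finset.mem_filter] at hb
  have hlt' : z b < z a := lt_of_le_of_ne hb.2.2 fun h => hb.1 (hz hb.2.1 ha h)
  have : orderStat A z k ≤ z b := by
    rw [orderStat_le_iff A z hk]
    refine le_trans (by omega) (Finset.card_le_card (s := S) fun i hi => ?_)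
    have hi' := hi
    simp only [hS, Finset.mem_erase, Finset.mem_filter] at hi'
    simp [hi'.2.1, hmax i hi]
  rw [hw, EReal.coe_le_coe_iff] at this
  exact absurd hlt' (not_lt.2 this)

/-- The lower and upper parts overlap exactly in the observation attaining the value. For `k = 0`
the value is `⊥`, attained by none, and the formula would be one too large. -/
theorem card_filter_orderStat_le (hz : Set.InjOn z A) {k : ℕ} (hk0 : k ≠ 0) (hk : k ≤ A.card) :
    (A.filter fun i => orderStat A z k ≤ (z i : EReal)).card = A.card - k + 1 := by
  obtain ⟨a, ha, hw⟩ := exists_orderStat_eq A z hk0 hk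
  have hle := card_filter_le_orderStat hz hk
  simp only [hw, EReal.coe_le_coe_iff] at hle ⊢
  have hunion : (A.filter fun i => z i ≤ z a) ∪ (A.filter fun i => z a ≤ z i) = A := by
    ext i
    simp only [Finset.mem_union, Finset.mem_filter]
    have := le_total (z i) (z a)
    tauto
  have hinter : (A.filter fun i => z i ≤ z a) ∩ (A.filter fun i => z a ≤ z i) = {a} := by
    ext i
    simp only [Finset.mem_inter, Finset.mem_filter, Finset.mem_singleton]
    constructor
    · rintro ⟨⟨hi, h1⟩, -, h2⟩
      exact hz hi ha (le_antisymm h1 h2)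
    · rintro rfl
      simp [ha]
  have := Finset.card_union_add_card_inter (A.filter fun i => z i ≤ z a)
    (A.filter fun i => z a ≤ z i)
  rw [hunion, hinter, Finset.card_singleton] at this
  omega

theorem orderStat_lt_orderStat (hz : Set.InjOn z A) {k m : ℕ} (hkm : k < m) (hm : m ≤ A.card) :
    orderStat A z k < orderStat A z m := by
  by_contra! h
  have hk := card_filter_le_orderStat hz (hkm.le.trans hm)
  have hm' := card_filter_le_orderStat hz hm
  have := Finset.card_le_card (s := A.filter fun i => (z i : EReal) ≤ orderStat A z m)
    (t := A.filter fun i => (z i : EReal) ≤ orderStat A z k)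
    (Finset.monotone_filter_right _ fun i _ hi => hi.trans h)
  omega

/-- Rewrites a limit as the conjunction of the conditions imposed by the deleted observations, the
form in which cuts produce it. For `k = 0` both sides hold trivially. -/
theorem orderStat_lt_coe_iff {k : ℕ} (hk : k ≤ A.card) (c : ℝ) :
    orderStat A z k < c ↔ ∀ i ∈ A, (z i : EReal) ≤ orderStat A z k → z i < c := by
  constructor
  · intro h i _ hi
    exact EReal.coe_lt_coe_iff.1 (hi.trans_lt h)
  · intro h
    rcases eq_or_ne k 0 with rfl | hk0
    · simp [orderStat_zero, EReal.bot_lt_coe]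
    · obtain ⟨a, ha, hw⟩ := exists_orderStat_eq A z hk0 hk
      rw [hw]
      exact EReal.coe_lt_coe_iff.2 (h a ha hw.ge)

theorem coe_lt_orderStat_iff {k : ℕ} (hk0 : k ≠ 0) (hk : k ≤ A.card) (c : ℝ) :
    (c : EReal) < orderStat A z k ↔ ∀ i ∈ A, orderStat A z k ≤ (z i : EReal) → c < z i := by
  constructor
  · intro h i _ hi
    exact EReal.coe_lt_coe_iff.1 (h.trans_le hi)
  · intro h
    obtain ⟨a, ha, hw⟩ := exists_orderStat_eq A z hk0 hk
    rw [hw]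
    exact EReal.coe_lt_coe_iff.2 (h a ha hw.le)

end OrderStat

/-! ### Successive one-sided cuts. -/

section CutRegion

variable {E ι : Type*} [DecidableEq ι]

/-- The region left by the cuts `l`: the first cut `f` deletes the observation of `A` at which `f`
is largest, together with all points at which `f` is not smaller; the other cuts follow with the
observations that are left. -/
def cutRegion (x : ι → E) : List (E → ℝ) → Finset ι → Set E
  | [], _ => Set.univ
  | f :: l, A => {v | ∀ i ∈ A, (∀ j ∈ A, j ≠ i → f (x j) < f (x i)) →
      f v < f (x i) ∧ v ∈ cutRegion x l (A.erase i)}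

theorem cutRegion_cons_of_max (x : ι → E) (f : E → ℝ) (l : List (E → ℝ)) {A : Finset ι} {i : ι}
    (hi : i ∈ A) (hmax : ∀ j ∈ A, j ≠ i → f (x j) < f (x i)) :
    cutRegion x (f :: l) A = {v | f v < f (x i)} ∩ cutRegion x l (A.erase i) := by
  ext v
  constructor
  · intro h
    exact h i hi hmax
  · intro h k hk hkmax
    have : k = i := by
      by_contra hne
      exact lt_asymm (hmax k hk hne) (hkmax i hi (Ne.symm hne))
    rw [this]
    exact h

/-- Allows the observations left after a cut to be reindexed as a sample of smaller size. -/
theorem cutRegion_map {κ : Type*} [DecidableEq κ] (x : ι → E) (e : κ ↪ ι) (l : List (E → ℝ))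
    (A : Finset κ) : cutRegion x l (A.map e) = cutRegion (x ∘ e) l A := by
  induction l generalizing A with
  | nil => rfl
  | cons f l ih =>
    ext v
    simp only [cutRegion, Set.mem_ofPred_eq, Finset.forall_mem_map, ne_eq, EmbeddingLike.apply_eq_iff_eq,
      ← Finset.map_erase, ih, Function.comp_apply]

/-- Repeated cuts by the same `f` peel off the top block `T` one maximum at a time. -/
theorem cutRegion_replicate_append (x : ι → E) (f : E → ℝ) (l : List (E → ℝ)) {A T : Finset ι}
    (hf : Set.InjOn (fun i => f (x i)) A) (hTA : T ⊆ A)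
    (hT : ∀ t ∈ T, ∀ a ∈ A \ T, f (x a) < f (x t)) :
    cutRegion x (List.replicate T.card f ++ l) A =
      {v | ∀ t ∈ T, f v < f (x t)} ∩ cutRegion x l (A \ T) := by
  induction hk : T.card generalizing A T with
  | zero =>
    rw [Finset.card_eq_zero] at hk
    simp [hk]
  | succ k ih =>
    obtain ⟨i, hi, hmax⟩ := T.exists_max_image (fun i => f (x i)) (Finset.card_pos.1 (by omega))
    have hmaxA : ∀ j ∈ A, j ≠ i → f (x j) < f (x i) := by
      intro j hj hji
      by_cases hjT : j ∈ T
      · exact lt_of_le_of_ne (hmax j hjT) fun h => hji (hf hj (hTA hi) h)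
      · exact hT i hi j (by simp [hj, hjT])
    have hsdiff : A.erase i \ T.erase i = A \ T := by
      ext j
      simp only [Finset.mem_sdiff, Finset.mem_erase]
      have : j = i → j ∈ T := fun h => h ▸ hi
      tauto
    rw [List.replicate_succ, List.cons_append, cutRegion_cons_of_max x f _ (hTA hi) hmaxA,
      ih (A := A.erase i) (T := T.erase i) (hf.mono (by simp)) (Finset.erase_subset_erase _ hTA)
        (by rw [hsdiff]; exact fun t ht => hT t (Finset.mem_of_mem_erase ht))
        (by rw [Finset.card_erase_of_mem hi, hk]; rfl), hsdiff, ← Set.inter_assoc]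
    congr 1
    ext v
    simp only [Set.mem_inter_iff, Set.mem_ofPred_eq, Finset.mem_erase]
    constructor
    · rintro ⟨h1, h2⟩ t ht
      by_cases hti : t = i
      · rw [hti]; exact h1
      · exact h2 t ⟨hti, ht⟩
    · exact fun h => ⟨h i hi, fun t ht => h t ht.2⟩

end CutRegion

/-! ### The tolerance limits as a sequence of cuts. -/

section Bridge

variable {n N : ℕ} {r s : Fin n → ℕ}

/-- The cuts by the negated coordinate delete the `r` smallest observations `T₁`; those by the
coordinate delete `T₂`, the `s`-th and everything above. The blocks are disjoint because the lower
limit is below the upper one, so `s - r - 1` observations remain. -/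
theorem cutRegion_coordinate {x : Fin N → Fin n → ℝ} (hx : ∀ j, Function.Injective fun i => x i j)
    {j : ℕ} (hj : j < n) (hlt : r ⟨j, hj⟩ < s ⟨j, hj⟩)
    (hs : s ⟨j, hj⟩ ≤ (survivors r s x j).card) (l : List ((Fin n → ℝ) → ℝ)) :
    (survivors r s x (j + 1)).card + r ⟨j, hj⟩ + 1 = s ⟨j, hj⟩ ∧
    cutRegion x (List.replicate (r ⟨j, hj⟩) (fun v => -v ⟨j, hj⟩) ++
      (List.replicate ((survivors r s x j).card - s ⟨j, hj⟩ + 1) (fun v => v ⟨j, hj⟩) ++ l))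
        (survivors r s x j) =
      {v | lowerLimit r s x ⟨j, hj⟩ < (v ⟨j, hj⟩ : EReal) ∧
        (v ⟨j, hj⟩ : EReal) < upperLimit r s x ⟨j, hj⟩} ∩
      cutRegion x l (survivors r s x (j + 1)) := by
  set A := survivors r s x j with hA
  set z : Fin N → ℝ := fun i => x i ⟨j, hj⟩ with hz
  have hinj : Set.InjOn z A := (hx ⟨j, hj⟩).injOn
  set a := r ⟨j, hj⟩
  set b := s ⟨j, hj⟩
  have hL : lowerLimit r s x ⟨j, hj⟩ = orderStat A z a := rfl
  have hU : upperLimit r s x ⟨j, hj⟩ = orderStat A z b := rfl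
  have hb0 : b ≠ 0 := by omega
  set T₁ := A.filter fun i => (z i : EReal) ≤ orderStat A z a with hT₁
  set T₂ := A.filter fun i => orderStat A z b ≤ (z i : EReal) with hT₂
  have hc₁ : T₁.card = a := card_filter_le_orderStat hinj (by omega)
  have hc₂ : T₂.card = A.card - b + 1 := card_filter_orderStat_le hinj hb0 hs
  have hab : orderStat A z a < orderStat A z b := orderStat_lt_orderStat hinj hlt hs
  have hsurv : survivors r s x (j + 1) = (A \ T₁) \ T₂ := by
    ext i
    have : i ∈ survivors r s x (j + 1) ↔ i ∈ A ∧ ∀ _ : j < n,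
      orderStat A z a < (z i : EReal) ∧ (z i : EReal) < orderStat A z b := by
      simp only [survivors, Finset.mem_filter, hA, hz, a, b]
    rw [this]
    simp only [hT₁, hT₂, Finset.mem_sdiff, Finset.mem_filter, hj, forall_true_left, not_and, not_le]
    tauto
  have hsub : T₂ ⊆ A \ T₁ := by
    intro i hi
    simp only [hT₁, hT₂, Finset.mem_sdiff, Finset.mem_filter, not_and, not_le] at hi ⊢
    exact ⟨hi.1, fun _ => hab.trans_le hi.2⟩
  constructor
  · have h1 : ((A \ T₁) \ T₂).card = (A \ T₁).card - T₂.card :=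
      Finset.card_sdiff_of_subset hsub
    have h2 : (A \ T₁).card = A.card - T₁.card :=
      Finset.card_sdiff_of_subset (Finset.filter_subset _ _)
    have h3 := Finset.card_le_card hsub
    rw [hsurv]
    omega
  · rw [← hc₂]
    nth_rw 1 [← hc₁]
    rw [cutRegion_replicate_append, cutRegion_replicate_append, ← hsurv, ← Set.inter_assoc]
    · congr 1
      ext v
      rw [hL, hU]
      simp only [Set.mem_inter_iff, Set.mem_ofPred_eq, orderStat_lt_coe_iff (show a ≤ A.card by omega),
        coe_lt_orderStat_iff hb0 hs, hT₁, hT₂, Finset.mem_filter, and_imp, neg_lt_neg_iff, hz]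
    · exact hinj.mono (by simp)
    · exact hsub
    · intro t ht i hi
      simp only [hT₂, Finset.mem_sdiff, Finset.mem_filter, not_and, not_le] at ht hi
      exact EReal.coe_lt_coe_iff.1 ((hi.2 hi.1.1).trans_le ht.2)
    · exact fun i hi k hk h => hinj hi hk (neg_injective h)
    · exact Finset.filter_subset _ _
    · intro t ht i hi
      simp only [hT₁, Finset.mem_sdiff, Finset.mem_filter, not_and, not_le] at ht hi
      exact neg_lt_neg (EReal.coe_lt_coe_iff.1 (ht.2.trans_lt (hi.2 hi.1)))

theorem AdmissibleRanks.le_card_survivors (hrs : AdmissibleRanks N r s) {x : Fin N → Fin n → ℝ}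
    (hx : ∀ j, Function.Injective fun i => x i j) {j : ℕ} (hj : j < n) :
    s ⟨j, hj⟩ ≤ (survivors r s x j).card := by
  induction j with
  | zero => simpa [survivors] using hrs.first hj
  | succ j ih =>
    have h1 := (cutRegion_coordinate hx (Nat.lt_of_succ_lt hj) (hrs.lt _) (ih _) []).1
    have h2 := hrs.step j hj
    omega

/-- The order of quantifiers is the point: one list of cuts serves all samples without ties. -/
theorem AdmissibleRanks.exists_cuts (hrs : AdmissibleRanks N r s) {j : ℕ} (hj : j ≤ n) :
    ∃ l : List ((Fin n → ℝ) → ℝ), (∀ f ∈ l, ∃ k, f = (fun v => v k) ∨ f = fun v => -v k) ∧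
      ∀ x : Fin N → Fin n → ℝ, (∀ j, Function.Injective fun i => x i j) →
        l.length + (survivors r s x j).card = N ∧
        ∀ l', cutRegion x (l ++ l') Finset.univ =
          {v | ∀ i : Fin n, (i : ℕ) < j → lowerLimit r s x i < (v i : EReal) ∧
            (v i : EReal) < upperLimit r s x i} ∩ cutRegion x l' (survivors r s x j) := by
  induction j with
  | zero => exact ⟨[], by simp, fun x _ => by simp [survivors]⟩
  | succ j ih =>
    obtain ⟨l, hl, hlx⟩ := ih (by omega)
    -- `N - l.length` is the current number of survivors, expressed without the sample: each cut
    -- deletes one observation.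
    refine ⟨l ++ (List.replicate (r ⟨j, hj⟩) (fun v => -v ⟨j, hj⟩) ++
      List.replicate (N - l.length - s ⟨j, hj⟩ + 1) (fun v => v ⟨j, hj⟩)), ?_, ?_⟩
    · intro f hf
      simp only [List.mem_append, List.mem_replicate] at hf
      rcases hf with hf | hf | hf
      · exact hl f hf
      · exact ⟨_, .inr hf.2⟩
      · exact ⟨_, .inl hf.2⟩
    · intro x hx
      obtain ⟨hlen, hreg⟩ := hlx x hx
      have hs := hrs.le_card_survivors hx hj
      have hlt := hrs.lt ⟨j, hj⟩
      have hcard : N - l.length = (survivors r s x j).card := by omega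
      rw [hcard]
      constructor
      · have := (cutRegion_coordinate hx hj hlt hs []).1
        simp only [List.length_append, List.length_replicate]
        omega
      · intro l'
        rw [List.append_assoc, List.append_assoc, hreg, (cutRegion_coordinate hx hj hlt hs l').2,
          ← Set.inter_assoc]
        congr 1
        ext v
        simp only [Set.mem_inter_iff, Set.mem_ofPred_eq]
        constructor
        · rintro ⟨h1, h2⟩ i hi
          rcases Nat.lt_succ_iff_lt_or_eq.1 hi with hi | hi
          · exact h1 i hi
          · have : i = ⟨j, hj⟩ := Fin.ext hi
            rw [this]; exact h2
        · exact fun h => ⟨fun i hi => h i (by omega), h ⟨j, hj⟩ (by simp)⟩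

end Bridge

/-! ### The probability integral transform for finite atomless measures. -/

section IntegralTransform

open Filter

theorem continuous_measureReal_Iic (ν : Measure ℝ) [IsFiniteMeasure ν] [NullSingletonClass ν] :
    Continuous fun t => ν.real (Set.Iic t) := by
  have heq : (fun t => ν.real (Set.Iic t)) = fun t => ∫ s, (Set.Iic t).indicator 1 s ∂ν :=
    funext fun t => (integral_indicator_one measurableSet_Iic).symm
  rw [heq, continuous_iff_continuousAt]
  intro t₀
  refine continuousAt_of_dominated (bound := fun _ => 1) ?_ ?_ (integrable_const _) ?_
  · exact Eventually.of_forall fun t =>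
      ((measurable_const (a := (1 : ℝ))).indicator measurableSet_Iic).aestronglyMeasurable
  · refine Eventually.of_forall fun t => Eventually.of_forall fun s => ?_
    by_cases hs : s ≤ t <;> simp [Set.indicator, hs]
  · have hne : ∀ᵐ s ∂ν, s ≠ t₀ := by simp [ae_iff]
    filter_upwards [hne] with s hs
    rcases lt_or_gt_of_ne hs with h | h
    · refine (continuousAt_const (y := (1 : ℝ))).congr ?_
      filter_upwards [lt_mem_nhds h] with t ht
      simp [Set.indicator, ht.le]
    · refine (continuousAt_const (y := (0 : ℝ))).congr ?_
      filter_upwards [gt_mem_nhds h] with t ht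
      simp [Set.indicator, ht]

/-- The probability integral transform: `ν (Iic t)` is uniformly distributed under an atomless
measure `ν`. -/
theorem map_measureReal_Iic (ν : Measure ℝ) [IsFiniteMeasure ν] [NullSingletonClass ν] :
    ν.map (fun t => ν.real (Set.Iic t)) = volume.restrict (Set.Ioc 0 (ν.real Set.univ)) := by
  have hmono : Monotone fun t => ν.real (Set.Iic t) :=
    fun a b hab => measureReal_mono (Set.Iic_subset_Iic.2 hab)
  have hcont := continuous_measureReal_Iic ν
  refine Measure.ext_of_Iic _ _ fun c => ?_
  rw [Measure.map_apply hcont.measurable measurableSet_Iic,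
    Measure.restrict_apply measurableSet_Iic, Set.inter_comm, Set.Ioc_inter_Iic, Real.volume_Ioc,
    sub_zero]
  rcases le_or_gt (ν.real Set.univ) c with hc | hc
  · have : (fun t => ν.real (Set.Iic t)) ⁻¹' Set.Iic c = Set.univ := by
      ext t
      simpa using (measureReal_mono (Set.subset_univ _)).trans hc
    rw [this, inf_eq_left.2 hc, ofReal_measureReal]
  rw [inf_eq_right.2 hc.le]
  -- `S` is a closed lower set. If empty, then `c ≤ 0` and both sides vanish; otherwise it is
  -- bounded above, hence equal to `Iic (sSup S)`, and by continuity the value at its endpoint is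
  -- exactly `c`.
  set S := (fun t => ν.real (Set.Iic t)) ⁻¹' Set.Iic c with hS
  rcases S.eq_empty_or_nonempty with h | h
  · have hlim : Tendsto (fun t => ν.real (Set.Iic t)) atBot (𝓝 0) := by
      have h0 := tendsto_measure_iInter_atBot (μ := ν) (s := fun t : ℝ => Set.Iic t)
        (fun t => measurableSet_Iic.nullMeasurableSet) (fun _ _ hab => Set.Iic_subset_Iic.2 hab)
        ⟨0, measure_ne_top _ _⟩
      have hinter : ⋂ t : ℝ, Set.Iic t = ∅ := by
        ext u
        simpa using exists_lt u
      rw [hinter, measure_empty] at h0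
      exact (ENNReal.tendsto_toReal ENNReal.zero_ne_top).comp h0
    have : c ≤ 0 := ge_of_tendsto hlim (Eventually.of_forall fun t => by
      have : t ∉ S := by simp [h]
      simpa [hS] using (not_le.1 this).le)
    simp [h, ENNReal.ofReal_of_nonpos this]
  · have hlim : Tendsto (fun t => ν.real (Set.Iic t)) atTop (𝓝 (ν.real Set.univ)) :=
      (ENNReal.tendsto_toReal (measure_ne_top ν _)).comp (tendsto_measure_Iic_atTop ν)
    have hbdd : BddAbove S := by
      obtain ⟨b, hb⟩ := (hlim.eventually (lt_mem_nhds hc)).exists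
      refine ⟨b, fun t ht => ?_⟩
      by_contra! hbt
      exact absurd (hb.trans_le (hmono hbt.le)) (not_lt.2 ht)
    have hclosed : IsClosed S := isClosed_Iic.preimage hcont
    have hmem : sSup S ∈ S := hclosed.csSup_mem h hbdd
    have hSeq : S = Set.Iic (sSup S) := by
      ext t
      exact ⟨fun ht => le_csSup hbdd ht, fun ht => (hmono ht).trans hmem⟩
    have hval : ν.real (Set.Iic (sSup S)) = c := by
      refine le_antisymm hmem (ge_of_tendsto
        (hcont.continuousAt.mono_left (nhdsWithin_le_nhds (s := Set.Ioi (sSup S)))) ?_)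
      filter_upwards [self_mem_nhdsWithin] with t ht
      by_contra! hlt
      exact absurd (le_csSup hbdd hlt.le) (not_le.2 ht)
    rw [hSeq, ← hval, ofReal_measureReal]

variable {E : Type*} [MeasurableSpace E]

theorem lintegral_measureReal_lt (μ : Measure E) [IsFiniteMeasure μ] {f : E → ℝ}
    (hf : Measurable f) (hatom : ∀ c, μ {v | f v = c} = 0) {h : ℝ → ℝ≥0∞} (hh : Measurable h) :
    ∫⁻ v, h (μ.real {w | f w < f v}) ∂μ = ∫⁻ u in Set.Ioc 0 (μ.real Set.univ), h u := by
  have : NullSingletonClass (μ.map f) := ⟨fun c => by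
    rw [Measure.map_apply hf (measurableSet_singleton c)]
    exact hatom c⟩
  have key := map_measureReal_Iic (μ.map f)
  have huniv : (μ.map f).real Set.univ = μ.real Set.univ := by
    rw [map_measureReal_apply hf MeasurableSet.univ, Set.preimage_univ]
  rw [huniv] at key
  rw [← key, lintegral_map hh (continuous_measureReal_Iic _).measurable,
    lintegral_map (f := fun t => h ((μ.map f).real (Set.Iic t)))
      (hh.comp (continuous_measureReal_Iic _).measurable) hf]
  refine lintegral_congr fun v => ?_
  congr 1
  rw [← measureReal_congr (Iio_ae_eq_Iic (μ := μ.map f)), map_measureReal_apply hf measurableSet_Iio]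
  rfl

end IntegralTransform

/-! ### Distribution of the mass left after the cuts. -/

section CutMeasure

variable {E : Type*} [MeasurableSpace E]

theorem measurableSet_mem_cutRegion {ι : Type*} [DecidableEq ι] [Finite ι] {l : List (E → ℝ)}
    (hl : ∀ f ∈ l, Measurable f) (A : Finset ι) :
    MeasurableSet {p : (ι → E) × E | p.2 ∈ cutRegion p.1 l A} := by
  induction l generalizing A with
  | nil => simp [cutRegion]
  | cons f l ih =>
    have hf : Measurable f := hl f (by simp)
    have ih' := fun A => ih (fun g hg => hl g (by simp [hg])) A
    have hm : ∀ i, Measurable fun p : (ι → E) × E => f (p.1 i) := fun i => by fun_prop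
    have : {p : (ι → E) × E | p.2 ∈ cutRegion p.1 (f :: l) A} = ⋂ i ∈ A,
        ((⋂ j ∈ A.erase i, {p : (ι → E) × E | f (p.1 j) < f (p.1 i)})ᶜ ∪
          ({p : (ι → E) × E | f p.2 < f (p.1 i)} ∩
            {p : (ι → E) × E | p.2 ∈ cutRegion p.1 l (A.erase i)})) := by
      ext p
      simp only [cutRegion, Set.mem_ofPred_eq, Set.mem_iInter, Set.mem_union, Set.mem_compl_iff,
        Set.mem_inter_iff, Finset.mem_erase]
      refine forall₂_congr fun i _ => ?_
      rw [imp_iff_not_or]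
      have : (∀ j ∈ A, j ≠ i → f (p.1 j) < f (p.1 i)) ↔
        (∀ j, j ≠ i ∧ j ∈ A → f (p.1 j) < f (p.1 i)) := by
          refine forall_congr' fun j => ?_
          tauto
      rw [this]
    rw [this]
    refine Finset.measurableSet_biInter _ fun i _ => MeasurableSet.union (MeasurableSet.compl ?_)
      (MeasurableSet.inter ?_ (ih' _))
    · exact Finset.measurableSet_biInter _ fun j _ => measurableSet_lt (hm j) (hm i)
    · exact measurableSet_lt (hf.comp measurable_snd) (hm i)

theorem measurableSet_cutRegion {ι : Type*} [DecidableEq ι] [Finite ι] {l : List (E → ℝ)}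
    (hl : ∀ f ∈ l, Measurable f) (x : ι → E) (A : Finset ι) : MeasurableSet (cutRegion x l A) :=
  measurable_prodMk_left (measurableSet_mem_cutRegion hl A)

theorem measurable_measureReal_cutRegion {ι : Type*} [DecidableEq ι] [Finite ι]
    {l : List (E → ℝ)} (hl : ∀ f ∈ l, Measurable f) (A : Finset ι) (μ : Measure E)
    [IsFiniteMeasure μ] : Measurable fun x : ι → E => μ.real (cutRegion x l A) :=
  (measurable_measure_prodMk_left (measurableSet_mem_cutRegion hl A)).ennreal_toReal

/-- By Fubini: once the `i`-th observation is fixed, the `j`-th must lie in a null level set. -/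
theorem Measure.pi_setOf_apply_eq_apply {M : ℕ} {μ : Measure E} [IsFiniteMeasure μ]
    {f : E → ℝ} (hf : Measurable f) (hatom : ∀ c, μ {v | f v = c} = 0) {i j : Fin M} (hij : i ≠ j) :
    Measure.pi (fun _ : Fin M => μ) {x | f (x i) = f (x j)} = 0 := by
  obtain ⟨M, rfl⟩ := Nat.exists_eq_succ_of_ne_zero (show M ≠ 0 by rintro rfl; exact i.elim0)
  have hm : MeasurableSet {x : Fin (M + 1) → E | f (x i) = f (x j)} :=
    measurableSet_eq_fun (hf.comp (measurable_pi_apply i)) (hf.comp (measurable_pi_apply j))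
  have hmp := (measurePreserving_piFinSuccAbove (fun _ : Fin (M + 1) => μ) i).symm
  rw [← hmp.measure_preimage hm.nullMeasurableSet, Measure.measure_prod_null (hmp.measurable hm)]
  refine Filter.Eventually.of_forall fun v => ?_
  obtain ⟨k, rfl⟩ := Fin.exists_succAbove_eq hij.symm
  have : Prod.mk v ⁻¹' ((MeasurableEquiv.piFinSuccAbove (fun _ : Fin (M + 1) => E) i).symm ⁻¹'
      {x | f (x i) = f (x (i.succAbove k))}) = Function.eval k ⁻¹' {w | f w = f v} := by
    ext x
    simp [eq_comm]
  beta_reduce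
  rw [this]
  exact Measure.pi_eval_preimage_null _ (hatom _)

/-- The measure of the set of those samples of size `M` from a measure of total mass `m` for which
`k` successive cuts leave a region of measure greater than `γ`. -/
noncomputable def cutTail (γ : ℝ) : ℕ → ℕ → ℝ → ℝ≥0∞
  | 0, M, m => if γ < m then ENNReal.ofReal m ^ M else 0
  | k + 1, M, m => M * ∫⁻ u in Set.Ioc 0 m, cutTail γ k (M - 1) u

theorem measurable_cutTail (γ : ℝ) (k M : ℕ) : Measurable (cutTail γ k M) := by
  cases k with
  | zero =>
    exact Measurable.ite (measurableSet_lt measurable_const measurable_id) (by fun_prop)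
      measurable_const
  | succ k =>
    refine Measurable.const_mul (Monotone.measurable fun a b hab => ?_) _
    exact lintegral_mono_set (Set.Ioc_subset_Ioc_right hab)

/-- Induction over all finite measures, not only probabilities: the measure restricted below the
first cut is used unnormalized, so no conditional laws are needed. -/
theorem pi_lt_measureReal_cutRegion (γ : ℝ) {l : List (E → ℝ)} (hl : ∀ f ∈ l, Measurable f)
    {M : ℕ} (hM : l.length ≤ M) (μ : Measure E) [IsFiniteMeasure μ]
    (hatom : ∀ f ∈ l, ∀ c, μ {v | f v = c} = 0) :
    Measure.pi (fun _ : Fin M => μ) {x | γ < μ.real (cutRegion x l Finset.univ)} =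
      cutTail γ l.length M (μ.real Set.univ) := by
  induction l generalizing M μ with
  | nil =>
    by_cases h : γ < μ.real Set.univ <;> simp [cutRegion, cutTail, h, Measure.pi_univ]
  | cons f l ih =>
    obtain ⟨M, rfl⟩ := Nat.exists_eq_succ_of_ne_zero (show M ≠ 0 by simp at hM; omega)
    have hf : Measurable f := hl f (by simp)
    have hl' : ∀ g ∈ l, Measurable g := fun g hg => hl g (by simp [hg])
    have hfatom := hatom f (by simp)
    set S := {x : Fin (M + 1) → E | γ < μ.real (cutRegion x (f :: l) Finset.univ)} with hS
    have hSm : MeasurableSet S :=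
      measurableSet_lt measurable_const (measurable_measureReal_cutRegion hl _ μ)
    -- `D i` is the event that observation `i` is the strict maximum. Up to ties, a null set, these
    -- events partition the sample space, and they contribute equally; this gives the factor `M` in
    -- `cutTail`.
    set D : Fin (M + 1) → Set (Fin (M + 1) → E) :=
      fun i => {x | ∀ j, j ≠ i → f (x j) < f (x i)} with hD
    have hDm : ∀ i, MeasurableSet (D i) := fun i => by
      have : D i = ⋂ j, ⋂ _ : j ≠ i, {x | f (x j) < f (x i)} := by
        ext x; simp [hD]
      rw [this]
      exact MeasurableSet.iInter fun j => MeasurableSet.iInter fun _ =>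
        measurableSet_lt (hf.comp (measurable_pi_apply j)) (hf.comp (measurable_pi_apply i))
    have hdisj : Pairwise (Function.onFun Disjoint fun i => D i ∩ S) := by
      intro i j hij
      refine Set.disjoint_left.2 fun x hx hx' => ?_
      exact lt_asymm (hx.1 j hij.symm) (hx'.1 i hij)
    have hcover : (S : Set (Fin (M + 1) → E)) =ᵐ[Measure.pi fun _ => μ] ⋃ i, D i ∩ S := by
      have hne : ∀ᵐ x ∂Measure.pi (fun _ : Fin (M + 1) => μ), ∀ i j, i ≠ j → f (x i) ≠ f (x j) := by
        simp only [ae_all_iff]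
        intro i j hij
        simpa [ae_iff] using Measure.pi_setOf_apply_eq_apply hf hfatom hij
      filter_upwards [hne] with x hx
      refine propext ⟨fun h => ?_, fun h => ?_⟩
      · obtain ⟨i, -, hi⟩ := Finset.univ.exists_max_image (fun i => f (x i)) Finset.univ_nonempty
        exact Set.mem_iUnion.2 ⟨i, fun j hj => lt_of_le_of_ne (hi j (Finset.mem_univ j)) (hx j i hj), h⟩
      · obtain ⟨i, hi⟩ := Set.mem_iUnion.1 h
        exact hi.2
    rw [measure_congr hcover, measure_iUnion hdisj fun i => (hDm i).inter hSm, tsum_fintype]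
    have hterm : ∀ i, Measure.pi (fun _ : Fin (M + 1) => μ) (D i ∩ S) =
        ∫⁻ u in Set.Ioc 0 (μ.real Set.univ), cutTail γ l.length M u := by
      intro i
      have hmp := (measurePreserving_piFinSuccAbove (fun _ : Fin (M + 1) => μ) i).symm
      rw [← hmp.measure_preimage ((hDm i).inter hSm).nullMeasurableSet,
        Measure.prod_apply (hmp.measurable ((hDm i).inter hSm)),
        ← lintegral_measureReal_lt μ hf hfatom (measurable_cutTail γ _ _)]
      refine lintegral_congr fun v => ?_
      have hB : MeasurableSet {w | f w < f v} := measurableSet_lt hf measurable_const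
      have hih := ih hl' (M := M) (by simpa using hM) (μ.restrict {w | f w < f v})
        (fun g hg c => le_antisymm ((Measure.restrict_apply_le _ _).trans
          (hatom g (by simp [hg]) c).le) zero_le)
      rw [measureReal_restrict_apply_univ] at hih
      -- Requiring all other observations to lie in `{w | f w < f v}` turns the product measure into
      -- the product of the restricted measures.
      rw [← hih, ← Measure.restrict_pi_pi, Measure.restrict_apply]
      · congr 1
        ext x
        have hins : (MeasurableEquiv.piFinSuccAbove (fun _ : Fin (M + 1) => E) i).symm (v, x) =
          i.insertNth v x := rfl
        simp only [Set.mem_preimage, hins, Set.mem_inter_iff, Set.mem_ofPred_eq, Set.mem_pi,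
          Set.mem_univ, true_implies, hD, hS]
        rw [and_comm]
        have hforall : (∀ j, j ≠ i → f (i.insertNth (α := fun _ => E) v x j) <
            f (i.insertNth (α := fun _ => E) v x i)) ↔ ∀ j, f (x j) < f v := by
          rw [Fin.forall_iff_succAbove i]
          simp
        rw [hforall]
        refine and_congr_left fun hx => ?_
        rw [cutRegion_cons_of_max _ _ _ (Finset.mem_univ i) (fun j _ => hforall.2 hx j)]
        have herase : (Finset.univ : Finset (Fin (M + 1))).erase i =
            Finset.univ.map i.succAboveEmb := by
          ext j
          simp [Fin.exists_succAbove_eq_iff]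
        have hcomp : i.insertNth (α := fun _ => E) v x ∘ i.succAboveEmb = x := by
          ext j
          simp
        rw [herase, cutRegion_map, hcomp, Fin.insertNth_apply_same,
          measureReal_restrict_apply (measurableSet_cutRegion hl' _ _), Set.inter_comm]
      · exact measurableSet_lt measurable_const (measurable_measureReal_cutRegion hl' _ _)
    rw [Finset.sum_congr rfl fun i _ => hterm i]
    simp [cutTail]

end CutMeasure

/-! ### Solving the recursion by beta integrals. -/

section BetaTail

theorem setLIntegral_ofReal_sub_pow (k : ℕ) {u m : ℝ} (hum : u ≤ m) :
    ∫⁻ w in Set.Ioc u m, ENNReal.ofReal (w - u) ^ k =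
      ENNReal.ofReal ((m - u) ^ (k + 1) / (k + 1)) := by
  have h : ∫⁻ w in Set.Ioc u m, ENNReal.ofReal (w - u) ^ k =
      ∫⁻ w in Set.Ioc u m, ENNReal.ofReal ((w - u) ^ k) :=
    setLIntegral_congr_fun measurableSet_Ioc fun w hw =>
      (ENNReal.ofReal_pow (by linarith [hw.1]) k).symm
  rw [h, ← ofReal_integral_eq_lintegral_ofReal,
    ← intervalIntegral.integral_of_le hum,
    intervalIntegral.integral_comp_sub_right (fun w => w ^ k) u, integral_pow]
  · simp
  · exact (Continuous.integrableOn_Icc (by fun_prop)).mono_set Set.Ioc_subset_Icc_self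
  · filter_upwards [self_mem_ae_restrict measurableSet_Ioc] with w hw
    exact pow_nonneg (by linarith [hw.1]) _

/-- Here `a` observations survive `k + 1` cuts. Each further cut integrates over the previous mass
`w`; exchanging integrals leaves `∫ (w - u)^k dw` over `(u, m]`, which raises the exponent and
divides by `k + 1`. -/
theorem cutTail_succ {γ : ℝ} (hγ : 0 ≤ γ) (k a : ℕ) (m : ℝ) :
    cutTail γ (k + 1) (a + k + 1) m =
      ENNReal.ofReal ((a + k + 1).factorial / (a.factorial * k.factorial)) *
        ∫⁻ u in Set.Ioc γ m, ENNReal.ofReal u ^ a * ENNReal.ofReal (m - u) ^ k := by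
  induction k generalizing m with
  | zero =>
    have h1 : ∀ u, cutTail γ 0 a u = (Set.Ioi γ).indicator (fun u => ENNReal.ofReal u ^ a) u :=
      fun u => by simp [cutTail, Set.indicator]
    have h2 : Set.Ioi γ ∩ Set.Ioc 0 m = Set.Ioc γ m := by
      ext u
      simp only [Set.mem_inter_iff, Set.mem_Ioi, Set.mem_Ioc]
      exact ⟨fun h => ⟨h.1, h.2.2⟩, fun h => ⟨h.1, hγ.trans_lt h.1, h.2⟩⟩
    rw [cutTail]
    simp only [Nat.add_zero, Nat.add_sub_cancel, h1]
    rw [lintegral_indicator measurableSet_Ioi, Measure.restrict_restrict measurableSet_Ioi, h2]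
    have h3 : ((a + 1).factorial : ℝ) / (a.factorial * Nat.factorial 0) = (a + 1 : ℕ) := by
      rw [Nat.factorial_succ]
      have := a.factorial_ne_zero
      push_cast
      field_simp
      simp
    rw [h3, ENNReal.ofReal_natCast]
    simp
  | succ k ih =>
    rw [cutTail]
    have h0 : a + (k + 1) + 1 - 1 = a + k + 1 := by omega
    simp only [h0, ih]
    rw [lintegral_const_mul' _ _ ENNReal.ofReal_ne_top]
    -- The integrand on the triangle `γ < u ≤ w ≤ m`, extended by zero so that the order of
    -- integration can be exchanged.
    set F : ℝ → ℝ → ℝ≥0∞ := fun w u => (Set.Ioc 0 m).indicator 1 w * (Set.Ioc γ w).indicator 1 u *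
      (ENNReal.ofReal u ^ a * ENNReal.ofReal (w - u) ^ k) with hF
    have hleft : ∫⁻ w in Set.Ioc 0 m, ∫⁻ u in Set.Ioc γ w,
        ENNReal.ofReal u ^ a * ENNReal.ofReal (w - u) ^ k = ∫⁻ w, ∫⁻ u, F w u := by
      rw [← lintegral_indicator measurableSet_Ioc]
      refine lintegral_congr fun w => ?_
      by_cases hw : w ∈ Set.Ioc 0 m
      · rw [Set.indicator_of_mem hw, ← lintegral_indicator measurableSet_Ioc]
        refine lintegral_congr fun u => ?_
        by_cases hu : u ∈ Set.Ioc γ w <;>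
          simp only [hF, hw, hu, Set.indicator_of_mem, Set.indicator_of_notMem, not_false_eq_true,
            Pi.one_apply, one_mul, zero_mul]
      · simp [hF, hw]
    have hFm : Measurable (Function.uncurry F) := by
      have h1 : MeasurableSet {p : ℝ × ℝ | p.1 ∈ Set.Ioc 0 m} :=
        measurable_fst measurableSet_Ioc
      have h2 : MeasurableSet {p : ℝ × ℝ | p.2 ∈ Set.Ioc γ p.1} :=
        (measurableSet_lt measurable_const measurable_snd).inter
          (measurableSet_le measurable_snd measurable_fst)
      refine Measurable.mul (Measurable.mul ?_ ?_) (by fun_prop)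
      · exact (measurable_const (a := (1 : ℝ≥0∞))).indicator h1
      · exact (measurable_const (a := (1 : ℝ≥0∞))).indicator h2
    have hright : ∫⁻ u, ∫⁻ w, F w u = ∫⁻ u in Set.Ioc γ m, ENNReal.ofReal u ^ a *
        ENNReal.ofReal ((m - u) ^ (k + 1) / (k + 1)) := by
      rw [← lintegral_indicator measurableSet_Ioc]
      refine lintegral_congr fun u => ?_
      by_cases hu : u ∈ Set.Ioc γ m
      · rw [Set.indicator_of_mem hu, ← setLIntegral_ofReal_sub_pow k hu.2,
          ← lintegral_const_mul' _ _ (ENNReal.pow_ne_top ENNReal.ofReal_ne_top),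
          ← lintegral_indicator measurableSet_Ioc]
        refine lintegral_congr_ae ?_
        -- The two descriptions of the triangle disagree only on the diagonal, where `k = 0` would
        -- give a nonzero integrand.
        have hne : ∀ᵐ w : ℝ, w ≠ u := by simp [ae_iff]
        filter_upwards [hne] with w hwu
        by_cases hw : w ∈ Set.Ioc u m
        · have h1 : w ∈ Set.Ioc 0 m := ⟨by linarith [hu.1, hw.1], hw.2⟩
          have h2 : u ∈ Set.Ioc γ w := ⟨hu.1, hw.1.le⟩
          simp [hF, Set.indicator_of_mem h1, Set.indicator_of_mem h2, Set.indicator_of_mem hw]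
        · rw [Set.indicator_of_notMem hw]
          by_cases h1 : w ∈ Set.Ioc 0 m
          · have h2 : u ∉ Set.Ioc γ w := fun h =>
              hw ⟨lt_of_le_of_ne h.2 (Ne.symm hwu), h1.2⟩
            simp [hF, Set.indicator_of_notMem h2]
          · simp [hF, Set.indicator_of_notMem h1]
      · rw [Set.indicator_of_notMem hu]
        refine (lintegral_congr fun w => ?_).trans lintegral_zero
        by_cases h1 : w ∈ Set.Ioc 0 m
        · have h2 : u ∉ Set.Ioc γ w := fun h => hu ⟨h.1, h.2.trans h1.2⟩
          simp [hF, Set.indicator_of_notMem h2]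
        · simp [hF, Set.indicator_of_notMem h1]
    have hpow : ∫⁻ u in Set.Ioc γ m, ENNReal.ofReal u ^ a *
        ENNReal.ofReal ((m - u) ^ (k + 1) / (k + 1)) = ENNReal.ofReal (1 / (k + 1)) *
        ∫⁻ u in Set.Ioc γ m, ENNReal.ofReal u ^ a * ENNReal.ofReal (m - u) ^ (k + 1) := by
      rw [← lintegral_const_mul' _ _ ENNReal.ofReal_ne_top]
      refine setLIntegral_congr_fun measurableSet_Ioc fun u hu => ?_
      have : 0 ≤ m - u := by linarith [hu.2]
      rw [← ENNReal.ofReal_pow this, mul_left_comm, ← ENNReal.ofReal_mul (by positivity)]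
      congr 2
      ring
    rw [hleft, lintegral_lintegral_swap hFm.aemeasurable, hright, hpow, ← mul_assoc, ← mul_assoc,
      ← ENNReal.ofReal_natCast, ← ENNReal.ofReal_mul (by positivity),
      ← ENNReal.ofReal_mul (by positivity)]
    congr 2
    have h1 : a + (k + 1) + 1 = (a + k + 1) + 1 := by omega
    rw [h1, Nat.factorial_succ (a + k + 1), Nat.factorial_succ k]
    have := a.factorial_ne_zero
    have := k.factorial_ne_zero
    push_cast
    field_simp

theorem beta_natCast_add_one (a k : ℕ) :
    ProbabilityTheory.beta (a + 1) (k + 1) =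
      a.factorial * k.factorial / (a + k + 1).factorial := by
  have h : (a + 1 + (k + 1) : ℝ) = ((a + k + 1 : ℕ) : ℝ) + 1 := by push_cast; ring
  rw [ProbabilityTheory.beta, h, Real.Gamma_nat_eq_factorial, Real.Gamma_nat_eq_factorial,
    Real.Gamma_nat_eq_factorial]

theorem integral_pow_mul_one_sub_pow (a k : ℕ) :
    ∫ u in (0 : ℝ)..1, u ^ a * (1 - u) ^ k = ProbabilityTheory.beta (a + 1) (k + 1) := by
  rw [beta_eq_betaIntegralReal _ _ (by positivity) (by positivity), Complex.betaIntegral]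
  have : ∀ u : ℝ, (u : ℂ) ^ (((a + 1 : ℝ) : ℂ) - 1) * (1 - (u : ℂ)) ^ (((k + 1 : ℝ) : ℂ) - 1) =
      ((u ^ a * (1 - u) ^ k : ℝ) : ℂ) := by
    intro u
    push_cast
    rw [add_sub_cancel_right, add_sub_cancel_right, Complex.cpow_natCast, Complex.cpow_natCast]
  simp only [this]
  rw [intervalIntegral.integral_ofReal, Complex.ofReal_re]

theorem toReal_cutTail_succ_one {γ : ℝ} (hγ0 : 0 ≤ γ) (hγ1 : γ ≤ 1) (k a : ℕ) :
    (cutTail γ (k + 1) (a + k + 1) 1).toReal = 1 - regIncBeta γ (a + 1) (k + 1) := by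
  have hcont : Continuous fun u : ℝ => u ^ a * (1 - u) ^ k := by fun_prop
  have hbeta : ProbabilityTheory.beta (a + 1) (k + 1) ≠ 0 :=
    (beta_pos (by positivity) (by positivity)).ne'
  have hint : ∫⁻ u in Set.Ioc γ 1, ENNReal.ofReal u ^ a * ENNReal.ofReal (1 - u) ^ k =
      ENNReal.ofReal (∫ u in γ..1, u ^ a * (1 - u) ^ k) := by
    rw [intervalIntegral.integral_of_le hγ1, ofReal_integral_eq_lintegral_ofReal]
    · refine setLIntegral_congr_fun measurableSet_Ioc fun u hu => ?_
      have h0 : 0 ≤ u := by linarith [hu.1]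
      have h1 : 0 ≤ 1 - u := by linarith [hu.2]
      rw [ENNReal.ofReal_mul (by positivity), ENNReal.ofReal_pow h0, ENNReal.ofReal_pow h1]
    · exact hcont.integrableOn_Icc.mono_set Set.Ioc_subset_Icc_self
    · filter_upwards [self_mem_ae_restrict measurableSet_Ioc] with u hu
      have h0 : 0 ≤ u := by linarith [hu.1]
      have h1 : 0 ≤ 1 - u := by linarith [hu.2]
      simp only [Pi.zero_apply]
      positivity
  have hnonneg : 0 ≤ ∫ u in γ..1, u ^ a * (1 - u) ^ k := by
    refine intervalIntegral.integral_nonneg hγ1 fun u hu => ?_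
    have h0 : 0 ≤ u := by linarith [hu.1]
    have h1 : 0 ≤ 1 - u := by linarith [hu.2]
    positivity
  have hsplit := intervalIntegral.integral_add_adjacent_intervals (μ := volume)
    (hcont.intervalIntegrable 0 γ) (hcont.intervalIntegrable γ 1)
  rw [integral_pow_mul_one_sub_pow] at hsplit
  have hreg : regIncBeta γ (a + 1) (k + 1) =
      (∫ u in (0 : ℝ)..γ, u ^ a * (1 - u) ^ k) / ProbabilityTheory.beta (a + 1) (k + 1) := by
    simp only [regIncBeta, add_sub_cancel_right, Real.rpow_natCast]
  rw [cutTail_succ hγ0, hint, ← ENNReal.ofReal_mul (by positivity),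
    ENNReal.toReal_ofReal (by positivity), hreg, ← inv_div, ← beta_natCast_add_one]
  field_simp
  linarith

end BetaTail

/-! ### Measurability of the limits and of the region. -/

section Measurability

variable {n N : ℕ}

theorem measurable_orderStat {α : Type*} [MeasurableSpace α] (A : Finset (Fin N))
    {z : Fin N → α → ℝ} (hz : ∀ i, Measurable (z i)) (k : ℕ) :
    Measurable fun a => orderStat A (fun i => z i a) k := by
  rcases lt_or_ge A.card k with hk | hk
  · simp only [orderStat_of_card_lt A _ hk, measurable_const]
  rcases eq_or_ne k 0 with rfl | hk0
  · simp only [orderStat_zero, measurable_const]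
  refine measurable_of_Iic fun c => ?_
  induction c with
  | bot =>
    convert! MeasurableSet.empty
    ext a
    obtain ⟨i, -, hi⟩ := exists_orderStat_eq A (fun i => z i a) hk0 hk
    simp [hi]
  | top => simp
  | coe c =>
    have hset : (fun a => orderStat A (fun i => z i a) k) ⁻¹' Set.Iic (c : EReal) =
        {a | k ≤ ∑ i ∈ A, if z i a ≤ c then 1 else 0} := by
      ext a
      simp only [Set.mem_preimage, Set.mem_Iic, orderStat_le_iff A _ hk, Finset.card_filter,
        Set.mem_ofPred_eq]
    rw [hset]
    refine measurableSet_le measurable_const (Finset.measurable_fun_sum _ fun i _ => ?_)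
    exact Measurable.ite (measurableSet_le (hz i) measurable_const) measurable_const
      measurable_const

/-- The survivor set takes finitely many values, so a function of it can be glued from the pieces
where it is constant. -/
theorem measurable_of_finset {α β ι : Type*} [MeasurableSpace α] [MeasurableSpace β] [Finite ι]
    {B : α → Finset ι} (hB : ∀ A, MeasurableSet {a | B a = A}) {g : Finset ι → α → β}
    (hg : ∀ A, Measurable (g A)) : Measurable fun a => g (B a) a := by
  intro s hs
  have : (fun a => g (B a) a) ⁻¹' s = ⋃ A, {a | B a = A} ∩ g A ⁻¹' s := by
    ext a
    simp
  rw [this]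
  exact MeasurableSet.iUnion fun A => (hB A).inter (hg A hs)

variable (r s : Fin n → ℕ)

theorem measurableSet_survivors_eq (j : ℕ) (A : Finset (Fin N)) :
    MeasurableSet {x : Fin N → Fin n → ℝ | survivors r s x j = A} := by
  induction j generalizing A with
  | zero => simp [survivors]
  | succ j ih =>
    have hord : ∀ (h : j < n) k, Measurable fun x : Fin N → Fin n → ℝ =>
        orderStat (survivors r s x j) (fun l => x l ⟨j, h⟩) k := fun h k =>
      measurable_of_finset ih (g := fun A x => orderStat A (fun l => x l ⟨j, h⟩) k) fun A =>
        measurable_orderStat A (fun i => by fun_prop) k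
    have hcoe : ∀ (i : Fin N) (k : Fin n), Measurable fun x : Fin N → Fin n → ℝ =>
        (x i k : EReal) := fun i k => measurable_coe_real_ereal.comp (by fun_prop)
    have hmem : ∀ i, MeasurableSet {x : Fin N → Fin n → ℝ | i ∈ survivors r s x (j + 1)} := by
      intro i
      have hset : {x : Fin N → Fin n → ℝ | i ∈ survivors r s x (j + 1)} =
          (⋃ B : {B : Finset (Fin N) // i ∈ B}, {x | survivors r s x j = B}) ∩
          ⋂ h : j < n, {x : Fin N → Fin n → ℝ |
            orderStat (survivors r s x j) (fun l => x l ⟨j, h⟩) (r ⟨j, h⟩) < (x i ⟨j, h⟩ : EReal)} ∩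
            {x | (x i ⟨j, h⟩ : EReal) <
              orderStat (survivors r s x j) (fun l => x l ⟨j, h⟩) (s ⟨j, h⟩)} := by
        ext x
        simp only [survivors, Finset.mem_filter, Set.mem_inter_iff, Set.mem_iUnion, Set.mem_iInter,
          Set.mem_ofPred_eq, Subtype.exists, exists_prop, exists_eq_right']
      rw [hset]
      exact (MeasurableSet.iUnion fun B : {B : Finset (Fin N) // i ∈ B} => ih B.1).inter (MeasurableSet.iInter fun h =>
        (measurableSet_lt (hord h _) (hcoe _ _)).inter (measurableSet_lt (hcoe _ _) (hord h _)))
    have hset : {x : Fin N → Fin n → ℝ | survivors r s x (j + 1) = A} =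
        ⋂ i, {x | i ∈ survivors r s x (j + 1) ↔ i ∈ A} := by
      ext x
      simp [Finset.ext_iff]
    rw [hset]
    exact MeasurableSet.iInter fun i => (hmem i).iff (MeasurableSet.const _)

theorem measurable_lowerLimit (j : Fin n) :
    Measurable fun x : Fin N → Fin n → ℝ => lowerLimit r s x j :=
  measurable_of_finset (measurableSet_survivors_eq r s j)
    (g := fun A x => orderStat A (fun l => x l j) (r j)) fun A =>
      measurable_orderStat A (fun i => by fun_prop) _

theorem measurable_upperLimit (j : Fin n) :
    Measurable fun x : Fin N → Fin n → ℝ => upperLimit r s x j :=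
  measurable_of_finset (measurableSet_survivors_eq r s j)
    (g := fun A x => orderStat A (fun l => x l j) (s j)) fun A =>
      measurable_orderStat A (fun i => by fun_prop) _

theorem measurableSet_mem_toleranceBox :
    MeasurableSet {p : (Fin N → Fin n → ℝ) × (Fin n → ℝ) | p.2 ∈ toleranceBox r s p.1} := by
  have hcoe : ∀ j, Measurable fun p : (Fin N → Fin n → ℝ) × (Fin n → ℝ) => (p.2 j : EReal) :=
    fun j => measurable_coe_real_ereal.comp (by fun_prop)
  have : {p : (Fin N → Fin n → ℝ) × (Fin n → ℝ) | p.2 ∈ toleranceBox r s p.1} =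
      ⋂ j, {p | lowerLimit r s p.1 j ≤ (p.2 j : EReal)} ∩
        {p | (p.2 j : EReal) ≤ upperLimit r s p.1 j} := by
    ext p
    simp [toleranceBox]
  rw [this]
  exact MeasurableSet.iInter fun j =>
    (measurableSet_le ((measurable_lowerLimit r s j).comp measurable_fst) (hcoe j)).inter
      (measurableSet_le (hcoe j) ((measurable_upperLimit r s j).comp measurable_fst))

theorem measurableSet_toleranceBox (x : Fin N → Fin n → ℝ) :
    MeasurableSet (toleranceBox r s x) :=
  measurable_prodMk_left (measurableSet_mem_toleranceBox r s)

theorem measurable_measureReal_toleranceBox (μ : Measure (Fin n → ℝ)) [IsFiniteMeasure μ] :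
    Measurable fun x : Fin N → Fin n → ℝ => μ.real (toleranceBox r s x) :=
  (measurable_measure_prodMk_left (measurableSet_mem_toleranceBox r s)).ennreal_toReal

end Measurability

/-! ### Null sets and the final computation. -/

section Main

variable {n N : ℕ}

open Filter in
-- The part of the hyperplane below `t` has mass at most the increment of the joint distribution
-- function in direction `j`, which tends to `0`; countably many such parts cover the hyperplane.
theorem measure_coordinate_eq_of_continuous_jointCDF {μ : Measure (Fin n → ℝ)} [IsFiniteMeasure μ]
    (hμ : Continuous (jointCDF μ)) (j : Fin n) (c : ℝ) : μ {v | v j = c} = 0 := by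
  have hm : ∀ t : Fin n → ℝ, MeasurableSet {v : Fin n → ℝ | ∀ k, v k ≤ t k} := fun t =>
    measurableSet_Iic (a := t)
  have hnull : ∀ t : Fin n → ℝ, t j = c → μ {v | v j = c ∧ ∀ k, v k ≤ t k} = 0 := by
    intro t ht
    have hle : ∀ a < c, μ.real {v | v j = c ∧ ∀ k, v k ≤ t k} ≤
        jointCDF μ t - jointCDF μ (Function.update t j a) := by
      intro a ha
      have hsub : {v : Fin n → ℝ | ∀ k, v k ≤ Function.update t j a k} ⊆
          {v | ∀ k, v k ≤ t k} := by
        intro v hv k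
        rcases eq_or_ne k j with rfl | hk
        · have := hv k
          rw [Function.update_self] at this
          linarith
        · simpa [hk] using hv k
      rw [jointCDF, jointCDF, ← measureReal_sdiff hsub (hm _)]
      refine measureReal_mono ?_
      rintro v ⟨hv, hvt⟩
      refine ⟨hvt, fun h => ?_⟩
      have := h j
      rw [Function.update_self] at this
      linarith
    have hlim : Tendsto (fun a => jointCDF μ t - jointCDF μ (Function.update t j a)) (𝓝[<] c)
        (𝓝 0) := by
      have hcont : Continuous fun a => jointCDF μ t - jointCDF μ (Function.update t j a) :=
        continuous_const.sub (hμ.comp (continuous_const.update j continuous_id))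
      have := (hcont.tendsto c).mono_left (nhdsWithin_le_nhds (s := Set.Iio c))
      have hself : Function.update t j c = t := by rw [← ht, Function.update_eq_self]
      rwa [hself, sub_self] at this
    have h0 : μ.real {v | v j = c ∧ ∀ k, v k ≤ t k} ≤ 0 :=
      ge_of_tendsto hlim (by filter_upwards [self_mem_nhdsWithin] with a ha using hle a ha)
    exact (measureReal_eq_zero_iff).1 (le_antisymm h0 measureReal_nonneg)
  have hsub : {v : Fin n → ℝ | v j = c} ⊆
      ⋃ m : ℕ, {v | v j = c ∧ ∀ k, v k ≤ Function.update (fun _ => (m : ℝ)) j c k} := by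
    intro v hv
    obtain ⟨m, hm⟩ := exists_nat_ge (∑ k, |v k|)
    refine Set.mem_iUnion.2 ⟨m, hv, fun k => ?_⟩
    rcases eq_or_ne k j with rfl | hk
    · rw [Function.update_self]
      exact le_of_eq hv
    · rw [Function.update_of_ne hk]
      exact (le_abs_self _).trans ((Finset.single_le_sum (fun i _ => abs_nonneg (v i))
        (Finset.mem_univ k)).trans hm)
  exact measure_mono_null hsub (measure_iUnion_null fun m => hnull _ (by simp))

theorem toleranceBox_ae_eq {μ : Measure (Fin n → ℝ)} (hatom : ∀ j c, μ {v | v j = c} = 0)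
    (r s : Fin n → ℕ) (x : Fin N → Fin n → ℝ) :
    toleranceBox r s x =ᵐ[μ] {v | ∀ i : Fin n, lowerLimit r s x i < (v i : EReal) ∧
      (v i : EReal) < upperLimit r s x i} := by
  have hne : ∀ (j : Fin n) (c : EReal), ∀ᵐ v ∂μ, (v j : EReal) ≠ c := by
    intro j c
    induction c with
    | bot => simp
    | top => simp
    | coe c => simpa [ae_iff] using hatom j c
  have hall : ∀ᵐ v ∂μ, ∀ j : Fin n, (v j : EReal) ≠ lowerLimit r s x j ∧
      (v j : EReal) ≠ upperLimit r s x j :=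
    ae_all_iff.2 fun j => (hne j _).and (hne j _)
  filter_upwards [hall] with v hv
  refine propext (forall_congr' fun j => ?_)
  exact and_congr ⟨fun h => lt_of_le_of_ne h (hv j).1.symm, le_of_lt⟩
    ⟨fun h => lt_of_le_of_ne h (hv j).2, le_of_lt⟩

theorem ae_injective_coordinates {μ : Measure (Fin n → ℝ)} [IsFiniteMeasure μ]
    (hatom : ∀ j c, μ {v | v j = c} = 0) :
    ∀ᵐ x ∂Measure.pi (fun _ : Fin N => μ), ∀ j, Function.Injective fun i => x i j := by
  have : ∀ᵐ x ∂Measure.pi (fun _ : Fin N => μ), ∀ (j : Fin n) (i k : Fin N), i ≠ k →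
      x i j ≠ x k j := by
    simp only [ae_all_iff]
    intro j i k hik
    simpa [ae_iff] using
      Measure.pi_setOf_apply_eq_apply (f := fun v : Fin n → ℝ => v j) (measurable_pi_apply j) (hatom j) hik
  filter_upwards [this] with x hx j i k h
  by_contra hik
  exact hx j i k hik h

theorem measureReal_lt_toleranceBox {μ : Measure (Fin n → ℝ)} [IsProbabilityMeasure μ]
    (hatom : ∀ j c, μ {v | v j = c} = 0) {r s : Fin n → ℕ} (hrs : AdmissibleRanks N r s)
    {last : Fin n} (hlast : (last : ℕ) + 1 = n) {γ : ℝ} (hγ0 : 0 ≤ γ) (hγ1 : γ ≤ 1) :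
    (Measure.pi fun _ : Fin N => μ).real {x | γ < μ.real (toleranceBox r s x)} =
      1 - regIncBeta γ ((s last : ℝ) - r last) ((N : ℝ) - s last + r last + 1) := by
  obtain ⟨l, hl, hlx⟩ := hrs.exists_cuts le_rfl
  have hlm : ∀ f ∈ l, Measurable f := by
    intro f hf
    obtain ⟨k, rfl | rfl⟩ := hl f hf <;> fun_prop
  have hlatom : ∀ f ∈ l, ∀ c, μ {v | f v = c} = 0 := by
    intro f hf c
    obtain ⟨k, rfl | rfl⟩ := hl f hf
    · exact hatom k c
    · simpa [neg_eq_iff_eq_neg] using hatom k (-c)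
  obtain ⟨a, k, hlen, hN, hs⟩ : ∃ a k, l.length = k + 1 ∧ N = a + k + 1 ∧
      s last = a + r last + 1 := by
    -- The counts are the same for every sample without ties, so one explicit sample determines
    -- them.
    set x : Fin N → Fin n → ℝ := fun i _ => i
    have hx : ∀ j, Function.Injective fun i => x i j := fun j i k h =>
      Fin.ext (by simpa [x] using h)
    have h1 := (hlx x hx).1
    have h2 : s last ≤ (survivors r s x last).card := hrs.le_card_survivors hx last.2
    have h3 : (survivors r s x (last + 1)).card + r last + 1 = s last :=
      (cutRegion_coordinate hx last.2 (hrs.lt _) h2 []).1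
    have h4 : (survivors r s x last).card ≤ N := by
      simpa using Finset.card_le_univ (survivors r s x last)
    rw [hlast] at h3
    exact ⟨(survivors r s x n).card, l.length - 1, by omega, by omega, by omega⟩
  have hset : {x | γ < μ.real (toleranceBox r s x)} =ᵐ[Measure.pi fun _ : Fin N => μ]
      {x | γ < μ.real (cutRegion x l Finset.univ)} := by
    filter_upwards [ae_injective_coordinates hatom] with x hx
    have hreg := (hlx x hx).2 []
    simp only [List.append_nil, cutRegion, Set.inter_univ, Fin.is_lt, true_implies] at hreg
    refine propext ?_
    change γ < μ.real _ ↔ γ < μ.real _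
    rw [measureReal_congr (toleranceBox_ae_eq hatom r s x), hreg]
  rw [measureReal_congr hset, Measure.real,
    pi_lt_measureReal_cutRegion γ hlm (by omega) μ hlatom, probReal_univ, hlen, hN,
    toReal_cutTail_succ_one hγ0 hγ1, hs]
  congr 2 <;> push_cast <;> ring

theorem theorem5 {n N : ℕ} (hn : 2 ≤ n)
    {Ω : Type*} [MeasurableSpace Ω] (P : Measure Ω) [IsProbabilityMeasure P]
    (μ : Measure (Fin n → ℝ)) [IsProbabilityMeasure μ] (hμ : Continuous (jointCDF μ))
    (y : Fin N → Ω → Fin n → ℝ) (hy : ∀ i, Measurable (y i))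
    (hlaw : ∀ i, P.map (y i) = μ) (hindep : iIndepFun y P)
    (r s : Fin n → ℕ) (hrs : AdmissibleRanks N r s)
    (last : Fin n) (hlast : (last : ℕ) + 1 = n)
    (γ : ℝ) (hγ0 : 0 < γ) (hγ1 : γ < 1) :
    (∀ j, Measurable (fun ω => lowerLimit r s (fun i => y i ω) j) ∧
      Measurable (fun ω => upperLimit r s (fun i => y i ω) j)) ∧
    P.real {ω | γ < μ.real (toleranceBox r s (fun i => y i ω))} =
      1 - regIncBeta γ ((s last : ℝ) - r last) ((N : ℝ) - s last + r last + 1) ∧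
    ∀ g : (Fin n → ℝ) → ℝ, Measurable g → (∀ v, 0 ≤ g v) →
      μ = volume.withDensity (fun v => ENNReal.ofReal (g v)) →
      P.real {ω | γ < ∫ v in toleranceBox r s (fun i => y i ω), g v} =
        1 - regIncBeta γ ((s last : ℝ) - r last) ((N : ℝ) - s last + r last + 1) := by
  have hatom := measure_coordinate_eq_of_continuous_jointCDF hμ
  have hY : Measurable fun ω i => y i ω := measurable_pi_lambda _ hy
  have hmap : P.map (fun ω i => y i ω) = Measure.pi fun _ : Fin N => μ := by
    rw [(iIndepFun_iff_map_fun_eq_pi_map fun i => (hy i).aemeasurable).1 hindep]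
    simp only [hlaw]
  have hmain : P.real {ω | γ < μ.real (toleranceBox r s (fun i => y i ω))} =
      1 - regIncBeta γ ((s last : ℝ) - r last) ((N : ℝ) - s last + r last + 1) := by
    rw [← measureReal_lt_toleranceBox hatom hrs hlast hγ0.le hγ1.le, ← hmap]
    exact (map_measureReal_apply hY (measurableSet_lt measurable_const
      (measurable_measureReal_toleranceBox r s μ))).symm
  refine ⟨fun j => ⟨(measurable_lowerLimit r s j).comp hY, (measurable_upperLimit r s j).comp hY⟩,
    hmain, fun g hg hg0 hgμ => ?_⟩
  rw [← hmain]
  congr 1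
  ext ω
  have hint : ∫ v in toleranceBox r s (fun i => y i ω), g v =
      μ.real (toleranceBox r s (fun i => y i ω)) := by
    rw [integral_eq_lintegral_of_nonneg_ae (Filter.Eventually.of_forall hg0)
      hg.aestronglyMeasurable, Measure.real]
    conv_rhs => rw [hgμ, withDensity_apply _ (measurableSet_toleranceBox r s _)]
  simp only [Set.mem_ofPred_eq, hint]

end Main
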